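/- Theorem. Consider a participant with stable dynamics $x_{t+1}=Ax_t+Bw_t$, measurement $y_t=Cx_t+Dw_t$ and quantity of interest $z_t=Lx_t\in\mathbb R^q$, $q\ge 1$, where $A,B,C,D,L$ are real matrices, $w$ is a standard white noise, and $A$ is stable (all its eigenvalues lie in the open unit disc). Let $T$ be a diagonal matrix with diagonal entries in $\{0,1\}$ (selecting the private coordinates of $x$), let $\rho>0$ and $\mu,\lambda\in\mathbb R$. For a filter $\hat x_{t+1}=F\hat x_t+Gy_t$, $\hat z_t=H\hat x_t+Ky_t$ whose state has the same dimension as $x$, put $$\tilde A=\begin{bmatrix}A&0\\GC&F\end{bmatrix},\quad \tilde B=\begin{bmatrix}B\\GD\end{bmatrix},\quad \tilde C=\begin{bmatrix}L-KC&-H\end{bmatrix},\quad \tilde D=-KD,$$ so that $\tilde C(zI-\tilde A)^{-1}\tilde B+\tilde D$ is the transfer function from $w$ to the estimation error $z_t-\hat z_t$. Say that the filter $(F,G,H,K)$ is admissible if $F$ is stable and $$\|\tilde C(zI-\tilde A)^{-1}\tilde B+\tilde D\|_2^2\le\mu,\qquad \rho^2\,\|H(zI-F)^{-1}GCT+KCT\|_\infty^2\le\lambda,$$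 where $\|\mathcal G\|_2=\big(\frac1{2\pi}\int_{-\pi}^{\pi}\mathrm{Tr}(\mathcal G^*(e^{i\omega})\mathcal G(e^{i\omega}))\,d\omega\big)^{1/2}$ and $\|\mathcal G\|_\infty=\operatorname{ess\,sup}_{\omega\in[-\pi,\pi)}\sigma_{\max}(\mathcal G(e^{i\omega}))$, with $\sigma_{\max}$ the largest singular value. Suppose that there are real matrices $W,Y,Z,\hat F,\hat G,\hat H,\hat K$ of compatible sizes with $\mathrm{Tr}(W)<\mu$ and such that the following three symmetric matrices are positive definite ($*$ denotes the transpose of the corresponding block above the diagonal): $$\begin{bmatrix}W&L-\hat KC-\hat H&L-\hat KC&-\hat KD\\ *&Z&Z&0\\ *&*&Y&0\\ *&*&*&I\end{bmatrix}\succ0,\qquad \begin{bmatrix}Z&Z&0&0&0&0\\ *&Y&0&\hat F&0&\hat GCT\\ *&*&\frac{\lambda}{\rho^2}I&\hat H&0&\hat KCT\\ *&*&*&Z&Z&0\\ *&*&*&*&Y&0\\ *&*&*&*&*&I\end{bmatrix}\succ0,$$ $$\begin{bmatrix}Z&Z&ZA&ZA&ZB\\ *&Y&YA+\hat GC+\hat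 F&YA+\hat GC&YB+\hat GD\\ *&*&Z&Z&0\\ *&*&*&Y&0\\ *&*&*&*&I\end{bmatrix}\succ0.$$ Then an admissible filter exists. More precisely, $Z$ is invertible, there exist nonsingular matrices $U,V$ with $VU^T=I-YZ^{-1}$, and for any two such matrices the filter $$F=V^{-1}\hat FZ^{-1}U^{-T},\quad G=V^{-1}\hat G,\quad H=\hat HZ^{-1}U^{-T},\quad K=\hat K$$ is admissible. -/

import Mathlib

open MeasureTheory
open scoped ENNReal Matrix

noncomputable section

/-- Discrete-time (Schur) stability: every complex eigenvalue lies in the open unit disc. -/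
def IsSchurStable {n : Type*} [Fintype n] [DecidableEq n] (A : Matrix n n ℝ) : Prop :=
  ∀ z ∈ spectrum ℂ (A.map Complex.ofReal), ‖z‖ < 1

/-- The transfer function `C (z I - A)⁻¹ B + D` of a real state-space realization. -/
def transferFunction {n m q : Type*} [Fintype n] [DecidableEq n]
    (A : Matrix n n ℝ) (B : Matrix n m ℝ) (C : Matrix q n ℝ) (D : Matrix q m ℝ) (z : ℂ) :
    Matrix q m ℂ :=
  C.map Complex.ofReal * (z • (1 : Matrix n n ℂ) - A.map Complex.ofReal)⁻¹ * B.map Complex.ofReal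
    + D.map Complex.ofReal

/-- The largest singular value of a complex matrix (as a linear map between Euclidean spaces). -/
def sigmaMax {q m : Type*} [Fintype q] [Fintype m] [DecidableEq m] (M : Matrix q m ℂ) : ℝ :=
  (Matrix.toEuclideanLin M).singularValues 0

/-- The `H₂` norm `((1 / 2π) ∫_{-π}^{π} Tr (G(e^{iω})^* G(e^{iω})) dω)^{1/2}`,
with values in `[0, ∞]`. -/
def h2Norm {q m : Type*} [Fintype q] [Fintype m] (G : ℂ → Matrix q m ℂ) : ℝ≥0∞ :=
  (ENNReal.ofReal (1 / (2 * Real.pi)) *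
    ∫⁻ ω in Set.Ico (-Real.pi) Real.pi,
      ENNReal.ofReal
        (((G (Complex.exp (ω * Complex.I)))ᴴ * G (Complex.exp (ω * Complex.I))).trace).re)
    ^ (1 / 2 : ℝ)

/-- The `H_∞` norm `ess sup_{ω ∈ [-π, π)} σ_max (G(e^{iω}))`, with values in `[0, ∞]`. -/
def hinfNorm {q m : Type*} [Fintype q] [Fintype m] [DecidableEq m] (G : ℂ → Matrix q m ℂ) :
    ℝ≥0∞ :=
  essSup (fun ω : ℝ => ENNReal.ofReal (sigmaMax (G (Complex.exp (ω * Complex.I)))))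
    (volume.restrict (Set.Ico (-Real.pi) Real.pi))

/-- The diagonal 0-1 matrix that keeps the coordinates in `S` and sets the others to zero. -/
def selectionMatrix {n : Type*} [DecidableEq n] (S : Finset n) : Matrix n n ℝ :=
  Matrix.diagonal fun j => if j ∈ S then 1 else 0

/-- The symmetric block matrix `[M₁₁ M₁₂; * M₂₂]`, where `*` stands for the transpose of `M₁₂`. -/
def symBlock {a b : Type*} (M₁₁ : Matrix a a ℝ) (M₁₂ : Matrix a b ℝ) (M₂₂ : Matrix b b ℝ) :
    Matrix (a ⊕ b) (a ⊕ b) ℝ :=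
  Matrix.fromBlocks M₁₁ M₁₂ M₁₂ᵀ M₂₂

section Filter

variable {n m p q : Type*} [Fintype n] [DecidableEq n] [Fintype m] [DecidableEq m]
  [Fintype p] [DecidableEq p] [Fintype q] [DecidableEq q]

/-- Transfer function from the noise `w` to the estimation error `e = z - ẑ`, where
`x⁺ = A x + B w`, `y = C x + D w`, `z = L x`, and `x̂⁺ = F x̂ + G y`, `ẑ = H x̂ + K y`;
the state is `(x, x̂)`. -/
def errorTransfer (A : Matrix n n ℝ) (B : Matrix n m ℝ) (C : Matrix p n ℝ) (D : Matrix p m ℝ)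
    (L : Matrix q n ℝ) (F : Matrix n n ℝ) (G : Matrix n p ℝ) (H : Matrix q n ℝ)
    (K : Matrix q p ℝ) : ℂ → Matrix q m ℂ :=
  transferFunction
    (Matrix.fromBlocks A 0 (G * C) F)
    (Matrix.fromRows B (G * D))
    (Matrix.fromCols (L - K * C) (-H))
    (-(K * D))

/-- Transfer function `H (z I - F)⁻¹ G C T + K C T` from a variation of the private coordinates of
the participant's state to the variation of the filter output. -/
def sensitivityTransfer (C : Matrix p n ℝ) (T : Matrix n n ℝ) (F : Matrix n n ℝ)
    (G : Matrix n p ℝ) (H : Matrix q n ℝ) (K : Matrix q p ℝ) : ℂ → Matrix q n ℂ :=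
  transferFunction F (G * C * T) H (K * C * T)

/-- The filter `(F, G, H, K)` is stable, its squared `H₂` error norm is finite and at most `μ`, and
`ρ ^ 2` times its squared `H_∞` sensitivity norm is finite and at most `lam`. -/
def FilterConstraints (A : Matrix n n ℝ) (B : Matrix n m ℝ) (C : Matrix p n ℝ) (D : Matrix p m ℝ)
    (L : Matrix q n ℝ) (T : Matrix n n ℝ) (ρ μ lam : ℝ)
    (F : Matrix n n ℝ) (G : Matrix n p ℝ) (H : Matrix q n ℝ) (K : Matrix q p ℝ) : Prop :=
  IsSchurStable F ∧
  (h2Norm (errorTransfer A B C D L F G H K) ≠ ⊤ ∧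
    (h2Norm (errorTransfer A B C D L F G H K)).toReal ^ 2 ≤ μ) ∧
  (hinfNorm (sensitivityTransfer C T F G H K) ≠ ⊤ ∧
    ρ ^ 2 * (hinfNorm (sensitivityTransfer C T F G H K)).toReal ^ 2 ≤ lam)

/-- The `4 × 4` block matrix
`[W, L - K̂C - Ĥ, L - K̂C, -K̂D; *, Z, Z, 0; *, *, Y, 0; *, *, *, I]`. -/
def lmiOutput (C : Matrix p n ℝ) (D : Matrix p m ℝ) (L : Matrix q n ℝ)
    (W : Matrix q q ℝ) (Y Z : Matrix n n ℝ) (Hh : Matrix q n ℝ) (Kh : Matrix q p ℝ) :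
    Matrix (q ⊕ n ⊕ n ⊕ m) (q ⊕ n ⊕ n ⊕ m) ℝ :=
  symBlock W (Matrix.fromCols (L - Kh * C - Hh) (Matrix.fromCols (L - Kh * C) (-(Kh * D))))
    (symBlock Z (Matrix.fromCols Z 0)
      (symBlock Y 0 1))

/-- The `6 × 6` block matrix
`[Z, Z, 0, 0, 0, 0; *, Y, 0, F̂, 0, ĜCT; *, *, (lam/ρ²)I, Ĥ, 0, K̂CT; *, *, *, Z, Z, 0;
*, *, *, *, Y, 0; *, *, *, *, *, I]`. -/
def lmiSensitivity (C : Matrix p n ℝ) (T : Matrix n n ℝ) (ρ lam : ℝ)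
    (Y Z : Matrix n n ℝ) (Fh : Matrix n n ℝ) (Gh : Matrix n p ℝ) (Hh : Matrix q n ℝ)
    (Kh : Matrix q p ℝ) :
    Matrix (n ⊕ n ⊕ q ⊕ n ⊕ n ⊕ n) (n ⊕ n ⊕ q ⊕ n ⊕ n ⊕ n) ℝ :=
  symBlock Z (Matrix.fromCols Z 0)
    (symBlock Y
        (Matrix.fromCols 0 (Matrix.fromCols Fh (Matrix.fromCols 0 (Gh * C * T))))
      (symBlock ((lam / ρ ^ 2) • (1 : Matrix q q ℝ))
          (Matrix.fromCols Hh (Matrix.fromCols 0 (Kh * C * T)))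
        (symBlock Z (Matrix.fromCols Z 0)
          (symBlock Y 0 1))))

/-- The `5 × 5` block matrix
`[Z, Z, ZA, ZA, ZB; *, Y, YA + ĜC + F̂, YA + ĜC, YB + ĜD; *, *, Z, Z, 0; *, *, *, Y, 0;
*, *, *, *, I]`. -/
def lmiState (A : Matrix n n ℝ) (B : Matrix n m ℝ) (C : Matrix p n ℝ) (D : Matrix p m ℝ)
    (Y Z : Matrix n n ℝ) (Fh : Matrix n n ℝ) (Gh : Matrix n p ℝ) :
    Matrix (n ⊕ n ⊕ n ⊕ n ⊕ m) (n ⊕ n ⊕ n ⊕ n ⊕ m) ℝ :=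
  symBlock Z
      (Matrix.fromCols Z (Matrix.fromCols (Z * A) (Matrix.fromCols (Z * A) (Z * B))))
    (symBlock Y
        (Matrix.fromCols (Y * A + Gh * C + Fh)
          (Matrix.fromCols (Y * A + Gh * C) (Y * B + Gh * D)))
      (symBlock Z (Matrix.fromCols Z 0)
        (symBlock Y 0 1)))

end Filter

end

/-! Write `Δ = Y - Z`. Testing the third inequality on `(x, -x, 0, 0, 0)` gives `Δ ≻ 0`. Since `V Uᵀ
= 1 - Y Z⁻¹ = -Δ Z⁻¹`, one has `V⁻¹ = -Uᵀ Z Δ⁻¹`, so each filter in the statement is the single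
filter `(-Δ⁻¹ F̂, -Δ⁻¹ Ĝ, Ĥ, K̂)` after the state change `R = Uᵀ Z`. Stability and both transfer
functions do not depend on `R`, so only this filter has to be checked (`filterConstraints_of_lmi`).

With filter state `ξ`, take the coordinates `(ξ, x - ξ)` for the error system and the Lyapunov
matrix `X = [Z Z; Z Y]`. The products of `X` with the state and input matrices are then affine in
`F̂` and `Ĝ`, and the third and first inequalities become the state and output inequalities of an
`H₂` bound (`posDef_errorState`, `posDef_errorOutput`). The second inequality, restricted to vectors
of the form `(b, -b, e, ξ, -ξ, v)`, is the bounded real inequality with Lyapunov matrix `Δ`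
(`posDef_boundedReal_of_lmiSensitivity`). The same inequalities make the filter and the error system
stable.

The `H₂` bound (`h2Norm_transferFunction_le`) is proved in the frequency domain: on the unit circle
`𝒢 𝒢* ≼ W + K + K*`, where `K` is linear in the resolvent. Cauchy's theorem gives the resolvent of a
stable matrix mean zero, so only `Tr W` survives integration. -/

section FilterDesign

open scoped ComplexOrder MatrixOrder

/-! ### Real symmetric inequalities as complex quadratic forms; Lyapunov's criterion. -/

section Complexification

variable {n : Type*} [Fintype n]

lemma Matrix.conjTranspose_map_ofReal {a b : Type*} (M : Matrix a b ℝ) :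
    (M.map Complex.ofReal)ᴴ = Mᵀ.map Complex.ofReal := by
  ext i j
  simp

lemma Matrix.map_ofReal_mul {m q : Type*} (M : Matrix m n ℝ) (N : Matrix n q ℝ) :
    (M * N).map Complex.ofReal = M.map Complex.ofReal * N.map Complex.ofReal := by
  ext i j
  simp [Matrix.mul_apply]

lemma Matrix.PosSemidef.map_ofReal {M : Matrix n n ℝ} (hM : M.PosSemidef) :
    (M.map Complex.ofReal).PosSemidef := by
  classical
  obtain ⟨B, rfl⟩ := CStarAlgebra.nonneg_iff_eq_star_mul_self.mp hM.nonneg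
  rw [Matrix.star_eq_conjTranspose, Matrix.map_ofReal_mul, Matrix.conjTranspose_eq_transpose_of_trivial,
    ← Matrix.conjTranspose_map_ofReal]
  exact Matrix.posSemidef_conjTranspose_mul_self _

variable [DecidableEq n]

lemma Matrix.IsUnit.map_ofReal {M : Matrix n n ℝ} (hM : IsUnit M) :
    IsUnit (M.map Complex.ofReal) :=
  hM.map (Complex.ofRealHom.mapMatrix : Matrix n n ℝ →+* Matrix n n ℂ)

lemma Matrix.PosDef.map_ofReal {M : Matrix n n ℝ} (hM : M.PosDef) :
    (M.map Complex.ofReal).PosDef :=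
  hM.posSemidef.map_ofReal.posDef_iff_isUnit.mpr (Matrix.IsUnit.map_ofReal hM.isUnit)

lemma IsSchurStable.isUnit_smul_one_sub {A : Matrix n n ℝ} (hA : IsSchurStable A) {z : ℂ}
    (hz : 1 ≤ ‖z‖) : IsUnit (z • (1 : Matrix n n ℂ) - A.map Complex.ofReal) := by
  by_contra h
  refine absurd (hA z ?_) (not_lt.mpr hz)
  rwa [spectrum.mem_iff, Algebra.algebraMap_eq_smul_one]

/-- The value of the quadratic form of a complexified symmetric block matrix. -/
lemma re_symBlock_form {a b : Type*} [Fintype a] [Fintype b] (P : Matrix a a ℝ) (M : Matrix a b ℝ)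
    (Q : Matrix b b ℝ) (u : a → ℂ) (v : b → ℂ) :
    (star (Sum.elim u v) ⬝ᵥ ((symBlock P M Q).map Complex.ofReal *ᵥ Sum.elim u v)).re =
      (star u ⬝ᵥ (P.map Complex.ofReal *ᵥ u)).re
        + 2 * (star u ⬝ᵥ (M.map Complex.ofReal *ᵥ v)).re
        + (star v ⬝ᵥ (Q.map Complex.ofReal *ᵥ v)).re := by
  have h : star v ⬝ᵥ (Mᵀ.map Complex.ofReal *ᵥ u) =
      star (star u ⬝ᵥ (M.map Complex.ofReal *ᵥ v)) := by
    rw [← Matrix.conjTranspose_map_ofReal, Matrix.star_dotProduct, Matrix.star_mulVec,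
      Matrix.conjTranspose_conjTranspose, ← Matrix.dotProduct_mulVec]
  have h' := congrArg Complex.re h
  simp only [symBlock, Matrix.fromBlocks_map, Matrix.fromBlocks_mulVec, Function.star_sumElim,
    Sum.elim_comp_inl, Sum.elim_comp_inr, sumElim_dotProduct_sumElim, dotProduct_add,
    Complex.add_re]
  rw [h']
  simp only [Complex.star_def, Complex.conj_re]
  ring

lemma symBlock_form {a b : Type*} [Fintype a] [Fintype b] (P : Matrix a a ℝ) (M : Matrix a b ℝ)
    (Q : Matrix b b ℝ) (u : a → ℝ) (v : b → ℝ) :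
    Sum.elim u v ⬝ᵥ (symBlock P M Q *ᵥ Sum.elim u v) =
      u ⬝ᵥ (P *ᵥ u) + 2 * (u ⬝ᵥ (M *ᵥ v)) + v ⬝ᵥ (Q *ᵥ v) := by
  have h : v ⬝ᵥ (Mᵀ *ᵥ u) = u ⬝ᵥ (M *ᵥ v) := by
    rw [Matrix.mulVec_transpose, Matrix.dotProduct_mulVec, dotProduct_comm]
  simp only [symBlock, Matrix.fromBlocks_mulVec,
    Sum.elim_comp_inl, Sum.elim_comp_inr, sumElim_dotProduct_sumElim, dotProduct_add, h]
  ring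

/-- Lyapunov's criterion in its Schur complement form. -/
lemma IsSchurStable.of_posDef_symBlock {P A : Matrix n n ℝ} (h : (symBlock P (P * A) P).PosDef) :
    IsSchurStable A := by
  intro z hz
  rw [← Matrix.spectrum_toLin', ← Module.End.hasEigenvalue_iff_mem_spectrum] at hz
  obtain ⟨v, hv⟩ := hz.exists_hasEigenvector
  have hv1 : A.map Complex.ofReal *ᵥ v = z • v := by simpa using hv.apply_eq_smul
  have hv0 : v ≠ 0 := hv.2
  have key := fun u : n → ℂ => (Complex.pos_iff.mp
    (h.map_ofReal.dotProduct_mulVec_pos (x := Sum.elim u v) (by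
      intro h0; exact hv0 (by simpa using congrArg (· ∘ Sum.inr) h0)))).1
  -- For an eigenpair `(z, v)`, the vectors `(0, v)` and `(-z v, v)` give `v*Pv > 0` and `(1 - |z|²)
  -- v*Pv > 0`.
  have h1 := key 0
  have h2 := key (-(z • v))
  rw [re_symBlock_form] at h1 h2
  rw [Matrix.map_ofReal_mul, ← Matrix.mulVec_mulVec, hv1] at h2
  simp only [star_neg, star_smul, Matrix.mulVec_neg, Matrix.mulVec_smul, neg_dotProduct,
    dotProduct_neg, smul_dotProduct, dotProduct_smul, smul_eq_mul, Complex.neg_re] at h2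
  have hz2 : ∀ t : ℂ, (z * -(star z * t)).re = -(‖z‖ ^ 2 * t.re) := by
    intro t
    rw [mul_neg, ← mul_assoc, Complex.star_def, Complex.mul_conj, Complex.neg_re,
      Complex.re_ofReal_mul, Complex.normSq_eq_norm_sq]
  rw [hz2] at h2
  simp only [star_zero, zero_dotProduct, Complex.zero_re, mul_zero, zero_add] at h1
  by_contra! hz1
  nlinarith [mul_nonneg (sub_nonneg.mpr (one_le_pow₀ (n := 2) hz1)) h1.le]

end Complexification

/-! ### Bounding the `H_∞` norm by pointwise gain estimates. -/

section SingularValues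

variable {q m : Type*} [Fintype q] [Fintype m] [DecidableEq m]

lemma EuclideanSpace.re_star_dotProduct_self {ι : Type*} [Fintype ι] (x : EuclideanSpace ℂ ι) :
    (star x.ofLp ⬝ᵥ x.ofLp).re = ‖x‖ ^ 2 := by
  rw [← inner_self_eq_norm_sq (𝕜 := ℂ), EuclideanSpace.inner_eq_star_dotProduct,
    dotProduct_comm]
  rfl

lemma sigmaMax_le {M : Matrix q m ℂ} {c : ℝ}
    (h : ∀ v : m → ℂ, (star (M *ᵥ v) ⬝ᵥ (M *ᵥ v)).re ≤ c * (star v ⬝ᵥ v).re) :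
    sigmaMax M ≤ √c := by
  unfold sigmaMax
  set T := Matrix.toEuclideanLin M with hT
  rcases Nat.eq_zero_or_pos (Module.finrank ℂ (EuclideanSpace ℂ m)) with h0 | h0
  -- On the zero space every singular value is zero by convention.
  · rw [T.singularValues_of_finrank_le h0.le]
    exact Real.sqrt_nonneg c
  · obtain ⟨x, hx⟩ := (T.hasEigenvalue_adjoint_comp_self_sq_singularValues h0).exists_hasEigenvector
    have hx1 : ‖T x‖ ^ 2 = (T.singularValues 0) ^ 2 * ‖x‖ ^ 2 := by
      have h1 := congrArg (fun y => (inner ℂ x y).re) hx.apply_eq_smul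
      simp only [LinearMap.comp_apply, LinearMap.adjoint_inner_right, inner_smul_right,
        inner_self_eq_norm_sq_to_K] at h1
      norm_cast at h1
    have hx2 : ‖T x‖ ^ 2 ≤ c * ‖x‖ ^ 2 := by
      have := h x.ofLp
      rwa [show M *ᵥ x.ofLp = (T x).ofLp from rfl, EuclideanSpace.re_star_dotProduct_self,
        EuclideanSpace.re_star_dotProduct_self] at this
    have hx3 : 0 < ‖x‖ ^ 2 := by
      have := hx.2
      positivity
    exact Real.le_sqrt_of_sq_le (le_of_mul_le_mul_right (hx1 ▸ hx2) hx3)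

lemma hinfNorm_le {G : ℂ → Matrix q m ℂ} {c : ℝ}
    (h : ∀ z : ℂ, ‖z‖ = 1 → ∀ v : m → ℂ,
      (star (G z *ᵥ v) ⬝ᵥ (G z *ᵥ v)).re ≤ c * (star v ⬝ᵥ v).re) :
    hinfNorm G ≤ ENNReal.ofReal √c :=
  essSup_le_of_ae_le _ <| .of_forall fun ω =>
    ENNReal.ofReal_le_ofReal (sigmaMax_le (h _ (Complex.norm_exp_ofReal_mul_I ω)))

end SingularValues

/-! ### Bounded real lemma. -/

section BoundedReal

variable {n m q : Type*} [Fintype n] [DecidableEq n] [Fintype m] [DecidableEq m]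
  [Fintype q] [DecidableEq q]

/-- The sufficiency part of the bounded real lemma. -/
lemma hinfNorm_transferFunction_le {P F : Matrix n n ℝ} {G : Matrix n m ℝ} {H : Matrix q n ℝ}
    {J : Matrix q m ℝ} {c : ℝ} (hc : 0 < c) (hF : IsSchurStable F)
    (h : (symBlock (Matrix.fromBlocks P 0 0 (c • (1 : Matrix q q ℝ)))
      (Matrix.fromBlocks (P * F) (P * G) H J) (Matrix.fromBlocks P 0 0 1)).PosSemidef) :
    hinfNorm (transferFunction F G H J) ≤ ENNReal.ofReal √c := by
  refine hinfNorm_le fun z hz v => ?_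
  set y := transferFunction F G H J z *ᵥ v with hy
  have hU := hF.isUnit_smul_one_sub hz.ge
  set ξ := (z • (1 : Matrix n n ℂ) - F.map Complex.ofReal)⁻¹ *ᵥ (G.map Complex.ofReal *ᵥ v) with hξ
  have hy' : y = H.map Complex.ofReal *ᵥ ξ + J.map Complex.ofReal *ᵥ v := by
    rw [hy, hξ, transferFunction, Matrix.add_mulVec, Matrix.mulVec_mulVec, Matrix.mulVec_mulVec,
      Matrix.mul_assoc]
  have hξ' : F.map Complex.ofReal *ᵥ ξ + G.map Complex.ofReal *ᵥ v = z • ξ := by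
    have h1 : (z • (1 : Matrix n n ℂ) - F.map Complex.ofReal) *ᵥ ξ = G.map Complex.ofReal *ᵥ v := by
      rw [hξ, Matrix.mulVec_mulVec,
        Matrix.mul_nonsing_inv _ ((Matrix.isUnit_iff_isUnit_det _).mp hU), Matrix.one_mulVec]
    rw [← h1, Matrix.sub_mulVec, Matrix.smul_mulVec, Matrix.one_mulVec]
    abel
  -- The first two components minimise the form for given `(ξ, v)`. As `Fξ + Gv = zξ` with `|z| =
  -- 1`, the `P` terms cancel and `|v|² - c⁻¹|y|² ≥ 0` remains.
  have key := (Complex.nonneg_iff.mp (h.map_ofReal.dotProduct_mulVec_nonneg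
    (Sum.elim (Sum.elim (-(z • ξ)) (-((c⁻¹ : ℂ) • y))) (Sum.elim ξ v)))).1
  have hsm : (c • (1 : Matrix q q ℝ)).map Complex.ofReal = (c : ℂ) • (1 : Matrix q q ℂ) := by
    ext i j
    by_cases hij : i = j <;> simp [hij]
  have hz' : star z * z = 1 := by
    rw [Complex.star_def, ← Complex.normSq_eq_conj_mul_self, Complex.normSq_eq_norm_sq, hz]
    simp
  rw [re_symBlock_form] at key
  simp only [Matrix.fromBlocks_map, Matrix.fromBlocks_mulVec, Function.star_sumElim,
    Sum.elim_comp_inl, Sum.elim_comp_inr, sumElim_dotProduct_sumElim,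
    Matrix.map_ofReal_mul, ← Matrix.mulVec_mulVec, ← Matrix.mulVec_add, hξ', ← hy', hsm] at key
  have hcs : star ((c : ℂ)⁻¹) = (c : ℂ)⁻¹ := by
    rw [← Complex.ofReal_inv, Complex.star_def, Complex.conj_ofReal]
  have hcc : (c : ℂ)⁻¹ • (c : ℂ) • y = y := by
    rw [smul_smul, inv_mul_cancel₀ (by exact_mod_cast hc.ne'), one_smul]
  simp only [Matrix.map_zero _ Complex.ofReal_zero,
    Matrix.map_one _ Complex.ofReal_zero Complex.ofReal_one, Matrix.zero_mulVec, Matrix.one_mulVec,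
    Matrix.mulVec_neg, Matrix.mulVec_smul, Matrix.smul_mulVec, add_zero, zero_add, star_neg,
    star_smul, neg_dotProduct, dotProduct_neg, smul_dotProduct, dotProduct_smul, smul_eq_mul,
    smul_zero, neg_zero, hcc, hcs] at key
  have h1 : ∀ t : ℂ, z * -(star z * t) = -t := fun t => by
    linear_combination (-t) * hz'
  have h2 : ∀ t : ℂ, ((c : ℂ)⁻¹ * t).re = c⁻¹ * t.re := fun t => by
    rw [← Complex.ofReal_inv, Complex.re_ofReal_mul]
  simp only [h1, Complex.add_re, Complex.neg_re, h2, neg_neg] at key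
  have h3 : c⁻¹ * (star y ⬝ᵥ y).re ≤ (star v ⬝ᵥ v).re := by
    linarith
  rwa [inv_mul_le_iff₀ hc] at h3

end BoundedReal

/-! ### Resolvent of a stable matrix on the unit circle. -/

section Resolvent

variable {n : Type*} [Fintype n] [DecidableEq n]

/-- Passing to `w = z⁻¹` turns the exterior of the disc into the closed disc, where `(1 - wA)⁻¹` has
no pole, `w = 0` included; this is the domain needed for Cauchy's theorem. -/
lemma IsSchurStable.isUnit_one_sub_smul {A : Matrix n n ℝ} (hA : IsSchurStable A) {w : ℂ}
    (hw : ‖w‖ ≤ 1) : IsUnit ((1 : Matrix n n ℂ) - w • A.map Complex.ofReal) := by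
  rcases eq_or_ne w 0 with rfl | hw0
  · simp
  · have h := hA.isUnit_smul_one_sub (z := w⁻¹) (by
      rw [norm_inv]; exact (one_le_inv₀ (norm_pos_iff.mpr hw0)).mpr hw)
    have h2 := h.smul (Units.mk0 w hw0)
    simpa [Units.smul_def, smul_sub, smul_smul, hw0] using h2

section Analytic

attribute [local instance] Matrix.linftyOpNormedRing Matrix.linftyOpNormedAlgebra

lemma differentiableAt_trace_inv_mul {A M : Matrix n n ℂ} {w : ℂ}
    (hw : IsUnit ((1 : Matrix n n ℂ) - w • A)) :
    DifferentiableAt ℂ (fun w : ℂ => (((1 : Matrix n n ℂ) - w • A)⁻¹ * M).trace) w := by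
  have h1 : DifferentiableAt ℂ (fun w : ℂ => (1 : Matrix n n ℂ) - w • A) w := by fun_prop
  have h2 : DifferentiableAt ℂ (fun w : ℂ => ((1 : Matrix n n ℂ) - w • A)⁻¹) w := by
    simp only [Matrix.nonsing_inv_eq_ringInverse]
    exact (differentiableAt_inverse (𝕜 := ℂ) hw).comp w h1
  exact (LinearMap.toContinuousLinearMap (Matrix.traceLinearMap n ℂ ℂ)).differentiableAt.comp w
    (h2.mul_const M)

end Analytic

lemma IsSchurStable.resolvent_exp {A : Matrix n n ℝ} (hA : IsSchurStable A) {z w : ℂ}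
    (hzw : z * w = 1) (hw : ‖w‖ ≤ 1) :
    (z • (1 : Matrix n n ℂ) - A.map Complex.ofReal)⁻¹ =
      w • ((1 : Matrix n n ℂ) - w • A.map Complex.ofReal)⁻¹ := by
  have hU := (Matrix.isUnit_iff_isUnit_det _).mp (hA.isUnit_one_sub_smul hw)
  apply Matrix.inv_eq_right_inv
  rw [Matrix.mul_smul, ← Matrix.smul_mul, smul_sub, smul_smul, mul_comm w z, hzw, one_smul,
    Matrix.mul_nonsing_inv _ hU]

lemma IsSchurStable.continuous_trace_resolvent {A : Matrix n n ℝ} (hA : IsSchurStable A)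
    (M : Matrix n n ℂ) :
    Continuous fun ω : ℝ => ((Complex.exp (ω * Complex.I) • (1 : Matrix n n ℂ)
      - A.map Complex.ofReal)⁻¹ * M).trace := by
  have h : ∀ ω : ℝ, ((Complex.exp (ω * Complex.I) • (1 : Matrix n n ℂ)
      - A.map Complex.ofReal)⁻¹ * M).trace = Complex.exp (-(ω * Complex.I)) *
        (((1 : Matrix n n ℂ) - Complex.exp (-(ω * Complex.I)) • A.map Complex.ofReal)⁻¹ *
          M).trace := by
    intro ω
    rw [hA.resolvent_exp (w := Complex.exp (-(ω * Complex.I)))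
      (by rw [← Complex.exp_add]; simp) (by simp [Complex.norm_exp]),
      Matrix.smul_mul, Matrix.trace_smul, smul_eq_mul]
  simp only [h]
  refine continuous_iff_continuousAt.mpr fun ω => ?_
  have he : Continuous fun ω : ℝ => Complex.exp (-(ω * Complex.I)) := by fun_prop
  refine he.continuousAt.mul ?_
  exact ContinuousAt.comp (f := fun ω : ℝ => Complex.exp (-(ω * Complex.I)))
    (g := fun w : ℂ => (((1 : Matrix n n ℂ) - w • A.map Complex.ofReal)⁻¹ * M).trace)
    (differentiableAt_trace_inv_mul
      (hA.isUnit_one_sub_smul (by simp [Complex.norm_exp]))).continuousAt he.continuousAt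

/-- The resolvent of a stable matrix has mean zero on the unit circle. -/
lemma IsSchurStable.integral_trace_resolvent {A : Matrix n n ℝ} (hA : IsSchurStable A)
    (M : Matrix n n ℂ) :
    ∫ ω in (-Real.pi)..Real.pi, ((Complex.exp (ω * Complex.I) • (1 : Matrix n n ℂ)
      - A.map Complex.ofReal)⁻¹ * M).trace = 0 := by
  set f : ℝ → ℂ := fun ω => ((Complex.exp (ω * Complex.I) • (1 : Matrix n n ℂ)
      - A.map Complex.ofReal)⁻¹ * M).trace with hf
  set g : ℂ → ℂ := fun w => (((1 : Matrix n n ℂ) - w • A.map Complex.ofReal)⁻¹ * M).trace with hg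
  -- With `w = e^{iθ} = z⁻¹` the resolvent is `w (1 - wA)⁻¹`, and its factor `w` is, up to `i`, the
  -- factor `dw/dθ` of a contour integral.
  have hfg : ∀ θ : ℝ, Complex.I * f (-θ) = deriv (circleMap 0 1) θ • g (circleMap 0 1 θ) := by
    intro θ
    simp only [hf, hg]
    rw [hA.resolvent_exp (w := circleMap 0 1 θ)
      (by simp [circleMap, ← Complex.exp_add]) (by simp),
      Matrix.smul_mul, Matrix.trace_smul, deriv_circleMap]
    simp only [smul_eq_mul]
    ring
  have hc : (∮ w in C(0, 1), g w) = 0 := by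
    apply DiffContOnCl.circleIntegral_eq_zero zero_le_one
    apply DifferentiableOn.diffContOnCl
    intro w hw
    rw [closure_ball 0 one_ne_zero] at hw
    exact (differentiableAt_trace_inv_mul
      (hA.isUnit_one_sub_smul (by simpa using hw))).differentiableWithinAt
  -- Periodicity moves `[-π, π]` to the interval `[0, 2π]` of `circleIntegral`.
  have hper : Function.Periodic (fun θ : ℝ => f (-θ)) (2 * Real.pi) := by
    intro θ
    have : Complex.exp (((-(θ + 2 * Real.pi) : ℝ) : ℂ) * Complex.I) =
        Complex.exp (((-θ : ℝ) : ℂ) * Complex.I) := by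
      rw [← Complex.exp_periodic.sub_eq (x := ((-θ : ℝ) : ℂ) * Complex.I)]
      congr 1
      push_cast
      ring
    simp only [hf, this]
  have h1 := hper.intervalIntegral_add_eq (-Real.pi) 0
  rw [show -Real.pi + 2 * Real.pi = Real.pi by ring, zero_add] at h1
  have h2 := intervalIntegral.integral_comp_neg (a := -Real.pi) (b := Real.pi) f
  rw [neg_neg] at h2
  rw [← h2, h1]
  rw [circleIntegral] at hc
  simp only [← hfg] at hc
  rw [intervalIntegral.integral_const_mul] at hc
  simpa using hc

end Resolvent

lemma Matrix.PosDef.symBlock_inl {a b : Type*} [Fintype a] [Fintype b] {P : Matrix a a ℝ}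
    {M : Matrix a b ℝ} {Q : Matrix b b ℝ} (h : (symBlock P M Q).PosDef) : P.PosDef :=
  h.submatrix Sum.inl_injective

lemma Matrix.PosDef.symBlock_inr {a b : Type*} [Fintype a] [Fintype b] {P : Matrix a a ℝ}
    {M : Matrix a b ℝ} {Q : Matrix b b ℝ} (h : (symBlock P M Q).PosDef) : Q.PosDef :=
  h.submatrix Sum.inr_injective

/-! ### Gramian inequalities and the `H₂` bound. -/

section H2

variable {k m q : Type*} [Fintype k] [DecidableEq k] [Fintype m] [DecidableEq m] [Fintype q]

lemma Matrix.PosDef.schur_complement_symBlock {Q : Matrix q q ℝ} {M : Matrix q k ℝ}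
    {N : Matrix q m ℝ} {X : Matrix k k ℝ}
    (h : (symBlock Q (Matrix.fromCols M N) (symBlock X 0 1)).PosDef) :
    (Q - M * X⁻¹ * Mᵀ - N * Nᵀ).PosSemidef := by
  have hD := h.symBlock_inr
  have hX := (Matrix.isUnit_iff_isUnit_det _).mp hD.symBlock_inl.isUnit
  have hinv : (symBlock X (0 : Matrix k m ℝ) 1)⁻¹ = Matrix.fromBlocks X⁻¹ 0 0 1 := by
    apply Matrix.inv_eq_right_inv
    simp [symBlock, Matrix.fromBlocks_multiply, Matrix.mul_nonsing_inv _ hX]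
  have := hD.isUnit.invertible
  have h1 := (Matrix.PosDef.fromBlocks₂₂ Q (Matrix.fromCols M N) hD).mp (by
    simpa [symBlock] using h.posSemidef)
  rw [hinv] at h1
  simpa [Matrix.fromCols_mul_fromBlocks, Matrix.transpose_fromCols, Matrix.fromCols_mul_fromRows,
    Matrix.conjTranspose_eq_transpose_of_trivial, sub_sub] using h1

/-- The Schur complement is `X - XAX⁻¹AᵀX - XBBᵀX`; congruence by `X⁻¹` makes `X⁻¹` an upper bound
for the controllability Gramian. -/
lemma Matrix.PosDef.dual_lyapunov {X A : Matrix k k ℝ} {B : Matrix k m ℝ}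
    (h : (symBlock X (Matrix.fromCols (X * A) (X * B)) (symBlock X 0 1)).PosDef) :
    (X⁻¹ - A * X⁻¹ * Aᵀ - B * Bᵀ).PosSemidef := by
  have hX := h.symBlock_inl
  have hXu := (Matrix.isUnit_iff_isUnit_det _).mp hX.isUnit
  have hXt : Xᵀ = X := by
    simpa [Matrix.conjTranspose_eq_transpose_of_trivial] using hX.isHermitian.eq
  have h1 := h.schur_complement_symBlock.conjTranspose_mul_mul_same X⁻¹
  have h2 : (X⁻¹)ᴴ = X⁻¹ := by
    rw [Matrix.conjTranspose_eq_transpose_of_trivial, Matrix.transpose_nonsing_inv, hXt]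
  convert h1 using 1
  have h3 : ∀ N : Matrix k k ℝ, X⁻¹ * (X * N) = N := fun N => by
    rw [← Matrix.mul_assoc, Matrix.nonsing_inv_mul _ hXu, Matrix.one_mul]
  simp only [h2, Matrix.transpose_mul, hXt, Matrix.mul_sub, Matrix.sub_mul, Matrix.mul_assoc, h3,
    Matrix.mul_nonsing_inv _ hXu, Matrix.mul_one]

/-- Since `|z| = 1` and `zR = 1 + RA`, one has `RSR* = (zR)S(zR)* = (1 + RA)S(1 + RA)*`; the
quadratic term `RASA*R*` cancels, leaving an expression affine in `R` and `R*`. -/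
lemma resolvent_conj_identity {z : ℂ} (hz : star z * z = 1) {A S R : Matrix k k ℂ}
    (hR : R * (z • (1 : Matrix k k ℂ) - A) = 1) :
    R * (S - A * S * Aᴴ) * Rᴴ = S + R * A * S + S * Aᴴ * Rᴴ := by
  have h1 : z • R = 1 + R * A := by
    rw [← hR, Matrix.mul_sub, Matrix.mul_smul, Matrix.mul_one, sub_add_cancel]
  have h2 : star z • Rᴴ = 1 + Aᴴ * Rᴴ := by
    rw [← Matrix.conjTranspose_smul, h1]
    simp
  have h3 : R * S * Rᴴ = (1 + R * A) * S * (1 + Aᴴ * Rᴴ) := by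
    rw [← h1, ← h2, Matrix.smul_mul, Matrix.smul_mul, Matrix.mul_smul, smul_smul, mul_comm z, hz,
      one_smul]
  rw [Matrix.mul_sub, Matrix.sub_mul, h3]
  simp only [Matrix.add_mul, Matrix.mul_add, Matrix.one_mul, Matrix.mul_one, Matrix.mul_assoc]
  abel

/-- Pointwise bound of the squared Frobenius norm of a transfer function on the unit circle. -/
lemma re_trace_le_of_gramian {z : ℂ} (hz : star z * z = 1) {A S R : Matrix k k ℂ}
    {B : Matrix k m ℂ} {C : Matrix q k ℂ} {D : Matrix q m ℂ} {W : Matrix q q ℂ}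
    (hR : R * (z • (1 : Matrix k k ℂ) - A) = 1) (hSh : Sᴴ = S)
    (hS : (S - A * S * Aᴴ - B * Bᴴ).PosSemidef) (hW : (W - C * S * Cᴴ - D * Dᴴ).PosSemidef) :
    (((C * R * B + D)ᴴ * (C * R * B + D)).trace).re ≤
      W.trace.re + 2 * (R * ((B * Dᴴ + A * S * Cᴴ) * C)).trace.re := by
  set K := C * R * (B * Dᴴ + A * S * Cᴴ) with hK
  have h1 := hW.add (hS.mul_mul_conjTranspose_same (C * R))
  -- The output inequality plus the state inequality conjugated by `CR` is exactly `W + K + K* -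
  -- 𝒢𝒢*`.
  have h2 : (W - C * S * Cᴴ - D * Dᴴ) + (C * R) * (S - A * S * Aᴴ - B * Bᴴ) * (C * R)ᴴ =
      W + K + Kᴴ - (C * R * B + D) * (C * R * B + D)ᴴ := by
    have h3 : (C * R) * (S - A * S * Aᴴ - B * Bᴴ) * (C * R)ᴴ =
        C * (R * (S - A * S * Aᴴ) * Rᴴ) * Cᴴ - C * R * (B * Bᴴ) * (Rᴴ * Cᴴ) := by
      simp only [Matrix.conjTranspose_mul, Matrix.mul_sub, Matrix.sub_mul, Matrix.mul_assoc]
    rw [h3, resolvent_conj_identity hz hR, hK]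
    simp only [Matrix.conjTranspose_mul, Matrix.conjTranspose_add,
      Matrix.conjTranspose_conjTranspose, hSh, Matrix.mul_add, Matrix.add_mul, Matrix.mul_assoc]
    abel
  rw [h2] at h1
  have h4 := (Complex.nonneg_iff.mp h1.trace_nonneg).1
  rw [Matrix.trace_sub, Matrix.trace_add, Matrix.trace_add, Matrix.trace_conjTranspose,
    Matrix.trace_mul_comm _ ((C * R * B + D)ᴴ)] at h4
  have h5 : K.trace = (R * ((B * Dᴴ + A * S * Cᴴ) * C)).trace := by
    rw [hK, Matrix.mul_assoc, Matrix.trace_mul_comm, Matrix.mul_assoc]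
  simp only [Complex.sub_re, Complex.add_re, Complex.star_def, Complex.conj_re, h5] at h4
  linarith

/-- The majorant is nonnegative and continuous, so its lower integral is an ordinary integral, in
which the mean-zero term disappears. -/
lemma h2Norm_le_of_re_trace_le {G : ℂ → Matrix q m ℂ} {c : ℝ} {f : ℝ → ℂ} (hf : Continuous f)
    (hint : ∫ ω in (-Real.pi)..Real.pi, f ω = 0)
    (h : ∀ ω : ℝ, (((G (Complex.exp (ω * Complex.I)))ᴴ *
      G (Complex.exp (ω * Complex.I))).trace).re ≤ c + 2 * (f ω).re) :
    h2Norm G ≤ ENNReal.ofReal c ^ (1 / 2 : ℝ) := by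
  have hpi := Real.pi_pos
  have hg : Continuous fun ω : ℝ => c + 2 * (f ω).re := by fun_prop
  have hg0 : ∀ ω : ℝ, 0 ≤ c + 2 * (f ω).re := fun ω => le_trans
    (Complex.nonneg_iff.mp (Matrix.posSemidef_conjTranspose_mul_self
      (G (Complex.exp (ω * Complex.I)))).trace_nonneg).1 (h ω)
  have hre : ∫ ω in (-Real.pi)..Real.pi, (f ω).re = 0 := by
    have := intervalIntegral.intervalIntegral_re (𝕜 := ℂ)
      (hf.intervalIntegrable (μ := volume) (-Real.pi) Real.pi)
    rw [hint] at this
    simpa using this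
  have hval : ∫ ω in Set.Ico (-Real.pi) Real.pi, (c + 2 * (f ω).re) = 2 * Real.pi * c := by
    rw [integral_Ico_eq_integral_Ioc, ← intervalIntegral.integral_of_le (by linarith),
      intervalIntegral.integral_add (by simp)
        ((by fun_prop : Continuous fun ω => 2 * (f ω).re).intervalIntegrable _ _),
      intervalIntegral.integral_const_mul, hre, intervalIntegral.integral_const, smul_eq_mul]
    ring
  refine ENNReal.rpow_le_rpow ?_ (by norm_num)
  calc _ ≤ ENNReal.ofReal (1 / (2 * Real.pi)) *
        ∫⁻ ω in Set.Ico (-Real.pi) Real.pi, ENNReal.ofReal (c + 2 * (f ω).re) := by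
          gcongr with ω
          exact h ω
    _ = ENNReal.ofReal c := by
          rw [← ofReal_integral_eq_lintegral_ofReal
            ((hg.integrableOn_Icc).mono_set Set.Ico_subset_Icc_self) (.of_forall hg0), hval,
            ← ENNReal.ofReal_mul (by positivity)]
          congr 1
          field_simp

/-- The linear matrix inequality bound of the `H₂` norm. -/
lemma h2Norm_transferFunction_le {X A : Matrix k k ℝ} {B : Matrix k m ℝ} {C : Matrix q k ℝ}
    {D : Matrix q m ℝ} {W : Matrix q q ℝ} (hA : IsSchurStable A)
    (hState : (symBlock X (Matrix.fromCols (X * A) (X * B)) (symBlock X 0 1)).PosDef)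
    (hOutput : (symBlock W (Matrix.fromCols C D) (symBlock X 0 1)).PosDef) :
    h2Norm (transferFunction A B C D) ≤ ENNReal.ofReal W.trace ^ (1 / 2 : ℝ) := by
  have hXt : (X⁻¹)ᵀ = X⁻¹ := by
    simpa [Matrix.conjTranspose_eq_transpose_of_trivial] using
      hState.symBlock_inl.inv.isHermitian.eq
  have hS := hState.dual_lyapunov.map_ofReal
  have hO := hOutput.schur_complement_symBlock.map_ofReal
  simp only [Matrix.map_sub _ Complex.ofReal_sub, Matrix.map_ofReal_mul,
    ← Matrix.conjTranspose_map_ofReal] at hS hO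
  refine h2Norm_le_of_re_trace_le (hA.continuous_trace_resolvent
    ((B.map Complex.ofReal * (D.map Complex.ofReal)ᴴ + A.map Complex.ofReal *
      X⁻¹.map Complex.ofReal * (C.map Complex.ofReal)ᴴ) * C.map Complex.ofReal))
    (hA.integral_trace_resolvent _) fun ω => ?_
  have hz : ‖Complex.exp (ω * Complex.I)‖ = 1 := Complex.norm_exp_ofReal_mul_I ω
  have hW : W.trace = (W.map Complex.ofReal).trace.re := by
    simp [Matrix.trace]
  rw [hW]
  refine re_trace_le_of_gramian ?_ (Matrix.nonsing_inv_mul _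
    ((Matrix.isUnit_iff_isUnit_det _).mp (hA.isUnit_smul_one_sub hz.ge))) ?_ hS hO
  · rw [Complex.star_def, ← Complex.normSq_eq_conj_mul_self, Complex.normSq_eq_norm_sq, hz]
    simp
  · rw [Matrix.conjTranspose_map_ofReal, hXt]

end H2

/-! ### Invariance under change of state coordinates. -/

section Similarity

variable {k m q : Type*} [Fintype k] [DecidableEq k]

/-- Transfer functions are invariant under a change of the state coordinates. -/
lemma transferFunction_congr {A A' T : Matrix k k ℝ} {B B' : Matrix k m ℝ} {C C' : Matrix q k ℝ}
    {D : Matrix q m ℝ} (hT : IsUnit T) (hA : A * T = T * A') (hB : B = T * B') (hC : C * T = C') :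
    transferFunction A B C D = transferFunction A' B' C' D := by
  funext z
  have hTu := (Matrix.isUnit_iff_isUnit_det _).mp (Matrix.IsUnit.map_ofReal hT)
  have hA' := congrArg (Matrix.map · Complex.ofReal) hA
  simp only [Matrix.map_ofReal_mul] at hA'
  set Tc := T.map Complex.ofReal
  have h1 : (z • (1 : Matrix k k ℂ) - A.map Complex.ofReal) =
      Tc * (z • (1 : Matrix k k ℂ) - A'.map Complex.ofReal) * Tc⁻¹ := by
    rw [Matrix.mul_sub, ← hA', Matrix.sub_mul, Matrix.mul_assoc _ Tc, Matrix.mul_smul,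
      Matrix.mul_one, Matrix.smul_mul, Matrix.mul_nonsing_inv _ hTu, Matrix.mul_one]
  subst hB hC
  -- `Matrix.mul_inv_rev` needs no invertibility, so the identity also holds at the poles, where the
  -- inverse is zero by convention.
  simp only [transferFunction, h1, Matrix.mul_inv_rev, Matrix.map_ofReal_mul,
    Matrix.nonsing_inv_nonsing_inv _ hTu]
  have h2 : ∀ N : Matrix k m ℂ, Tc⁻¹ * (Tc * N) = N := fun N => by
    rw [← Matrix.mul_assoc, Matrix.nonsing_inv_mul _ hTu, Matrix.one_mul]
  simp only [Matrix.mul_assoc, Tc] at h2 ⊢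
  rw [h2]

lemma IsSchurStable.congr {A A' T : Matrix k k ℝ} (hT : IsUnit T) (hA : A * T = T * A')
    (h : IsSchurStable A') : IsSchurStable A := by
  have hTc := Matrix.IsUnit.map_ofReal hT
  have hTu := (Matrix.isUnit_iff_isUnit_det _).mp hTc
  have hA' := congrArg (Matrix.map · Complex.ofReal) hA
  simp only [Matrix.map_ofReal_mul] at hA'
  obtain ⟨u, hu⟩ := hTc
  intro z hz
  refine h z ?_
  have h1 : A.map Complex.ofReal = u * A'.map Complex.ofReal * (↑u⁻¹ : Matrix k k ℂ) := by
    rw [hu, ← hA', ← hu, Matrix.mul_assoc, Units.mul_inv, Matrix.mul_one]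
  rwa [h1, spectrum.units_conjugate] at hz

end Similarity

/-! ### From the three matrix inequalities to the filter and error systems. -/

section ClosedLoop

variable {n m p q : Type*} [Fintype n] [DecidableEq n] [Fintype m] [DecidableEq m]
  [Fintype p] [Fintype q] [DecidableEq q]

/-- The bounded real inequality, in the coordinates where the filter state is that of
`(-(Y - Z)⁻¹ Fh, -(Y - Z)⁻¹ Gh, Hh, Kh)`. -/
lemma posDef_boundedReal_of_lmiSensitivity {C : Matrix p n ℝ} {T : Matrix n n ℝ} {ρ lam : ℝ}
    {Y Z F : Matrix n n ℝ} {G : Matrix n p ℝ} {Fh : Matrix n n ℝ} {Gh : Matrix n p ℝ}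
    {Hh : Matrix q n ℝ} {Kh : Matrix q p ℝ}
    (h : (lmiSensitivity C T ρ lam Y Z Fh Gh Hh Kh).PosDef)
    (hF : (Y - Z) * F = -Fh) (hG : (Y - Z) * G = -Gh) :
    (symBlock (Matrix.fromBlocks (Y - Z) 0 0 ((lam / ρ ^ 2) • (1 : Matrix q q ℝ)))
      (Matrix.fromBlocks ((Y - Z) * F) ((Y - Z) * (G * C * T)) Hh (Kh * C * T))
      (Matrix.fromBlocks (Y - Z) 0 0 1)).PosDef := by
  have hZ : Zᵀ = Z := h.symBlock_inl.isHermitian.eq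
  have hY : Yᵀ = Y := h.symBlock_inr.symBlock_inl.isHermitian.eq
  have hGC : (Y - Z) * (G * C * T) = -(Gh * C * T) := by
    rw [Matrix.mul_assoc G, ← Matrix.mul_assoc, hG, Matrix.neg_mul, Matrix.mul_assoc]
  rw [hGC, hF]
  refine .of_dotProduct_mulVec_pos ?_ fun x hx => ?_
  · rw [Matrix.IsHermitian, Matrix.conjTranspose_eq_transpose_of_trivial]
    simp [symBlock, Matrix.fromBlocks_transpose, hY, hZ]
  · have key := h.dotProduct_mulVec_pos (x := Sum.elim (x ∘ Sum.inl ∘ Sum.inl)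
      (Sum.elim (-(x ∘ Sum.inl ∘ Sum.inl)) (Sum.elim (x ∘ Sum.inl ∘ Sum.inr)
        (Sum.elim (x ∘ Sum.inr ∘ Sum.inl) (Sum.elim (-(x ∘ Sum.inr ∘ Sum.inl))
          (x ∘ Sum.inr ∘ Sum.inr)))))) (by
      contrapose! hx
      funext i
      rcases i with (i | i) | (i | i)
      · simpa using congrFun hx (.inl i)
      · simpa using congrFun hx (.inr (.inr (.inl i)))
      · simpa using congrFun hx (.inr (.inr (.inr (.inl i))))
      · simpa using congrFun hx (.inr (.inr (.inr (.inr (.inr i))))))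
    have hx' : x = Sum.elim (Sum.elim (x ∘ Sum.inl ∘ Sum.inl) (x ∘ Sum.inl ∘ Sum.inr))
        (Sum.elim (x ∘ Sum.inr ∘ Sum.inl) (x ∘ Sum.inr ∘ Sum.inr)) := by
      funext i
      rcases i with (i | i) | (i | i) <;> rfl
    rw [hx']
    generalize x ∘ Sum.inl ∘ Sum.inl = b, x ∘ Sum.inl ∘ Sum.inr = e,
      x ∘ Sum.inr ∘ Sum.inl = ξ, x ∘ Sum.inr ∘ Sum.inr = v at key ⊢
    simp only [lmiSensitivity, star_trivial, symBlock_form, Matrix.fromCols_mulVec_sumElim,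
      Matrix.fromBlocks_mulVec, Sum.elim_comp_inl, Sum.elim_comp_inr, sumElim_dotProduct_sumElim,
      Matrix.zero_mulVec, Matrix.mulVec_neg, Matrix.neg_mulVec, Matrix.sub_mulVec, dotProduct_add,
      dotProduct_sub, dotProduct_neg, neg_dotProduct, dotProduct_zero, add_zero, zero_add,
      neg_neg] at key ⊢
    linarith

/-- The state matrix of the error dynamics, in the coordinates `(ξ, x - ξ)`. -/
def errorState (A : Matrix n n ℝ) (C : Matrix p n ℝ) (F : Matrix n n ℝ) (G : Matrix n p ℝ) :
    Matrix (n ⊕ n) (n ⊕ n) ℝ :=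
  Matrix.fromBlocks (G * C + F) (G * C) (A - G * C - F) (A - G * C)

/-- The input matrix of the error dynamics, in the coordinates `(ξ, x - ξ)`. -/
def errorInput (B : Matrix n m ℝ) (D : Matrix p m ℝ) (G : Matrix n p ℝ) : Matrix (n ⊕ n) m ℝ :=
  Matrix.fromRows (G * D) (B - G * D)

/-- The output matrix of the error dynamics, in the coordinates `(ξ, x - ξ)`. -/
def errorOutput (C : Matrix p n ℝ) (L : Matrix q n ℝ) (H : Matrix q n ℝ) (K : Matrix q p ℝ) :
    Matrix q (n ⊕ n) ℝ :=
  Matrix.fromCols (L - K * C - H) (L - K * C)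

lemma errorTransfer_eq {A : Matrix n n ℝ} {B : Matrix n m ℝ} {C : Matrix p n ℝ}
    {D : Matrix p m ℝ} {L : Matrix q n ℝ} {R F : Matrix n n ℝ} {G : Matrix n p ℝ}
    {H : Matrix q n ℝ} {K : Matrix q p ℝ} (hR : IsUnit R) :
    errorTransfer A B C D L (R * F * R⁻¹) (R * G) (H * R⁻¹) K =
      transferFunction (errorState A C F G) (errorInput B D G) (errorOutput C L H K)
        (-(K * D)) := by
  have hRu := (Matrix.isUnit_iff_isUnit_det _).mp hR
  -- This matrix sends `(ξ, x - ξ)` to `(x, Rξ)`, the original plant and filter states.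
  have hT : IsUnit (Matrix.fromBlocks 1 1 R 0 : Matrix (n ⊕ n) (n ⊕ n) ℝ) := by
    refine (Matrix.isUnit_iff_isUnit_det _).mpr (Matrix.isUnit_det_of_right_inverse
      (B := Matrix.fromBlocks 0 R⁻¹ 1 (-R⁻¹)) ?_)
    simp [Matrix.fromBlocks_multiply, Matrix.mul_nonsing_inv _ hRu]
  refine transferFunction_congr hT ?_ ?_ ?_
  · simp [errorState, Matrix.fromBlocks_multiply, Matrix.mul_assoc, Matrix.mul_add,
      Matrix.nonsing_inv_mul _ hRu]
  · simp [errorInput, Matrix.fromBlocks_mul_fromRows, Matrix.mul_assoc]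
  · simp [errorOutput, Matrix.fromCols_mul_fromBlocks, Matrix.mul_assoc,
      Matrix.nonsing_inv_mul _ hRu, sub_eq_add_neg]

/-- In the first block row of `X` times the state matrix, the filter terms cancel and leave `ZA`; in
the second they enter through `-(Y - Z)`, that is, as `F̂` and `ĜC`. What remains is the given
inequality up to reassociation of the index type. -/
lemma posDef_errorState {A : Matrix n n ℝ} {B : Matrix n m ℝ} {C : Matrix p n ℝ}
    {D : Matrix p m ℝ} {Y Z F : Matrix n n ℝ} {G : Matrix n p ℝ} {Fh : Matrix n n ℝ}
    {Gh : Matrix n p ℝ} (h : (lmiState A B C D Y Z Fh Gh).PosDef)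
    (hF : (Y - Z) * F = -Fh) (hG : (Y - Z) * G = -Gh) :
    (symBlock (symBlock Z Z Y) (Matrix.fromCols (symBlock Z Z Y * errorState A C F G)
      (symBlock Z Z Y * errorInput B D G)) (symBlock (symBlock Z Z Y) 0 1)).PosDef := by
  have hZ : Zᵀ = Z := h.symBlock_inl.isHermitian.eq
  have hFh : Fh = Z * F - Y * F := by rw [← sub_mul, ← neg_sub, neg_mul, hF, neg_neg]
  have hGh : Gh = Z * G - Y * G := by rw [← Matrix.sub_mul, ← neg_sub, Matrix.neg_mul, hG, neg_neg]
  have hXA : symBlock Z Z Y * errorState A C F G = Matrix.fromBlocks (Z * A) (Z * A)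
      (Y * A + Gh * C + Fh) (Y * A + Gh * C) := by
    simp only [symBlock, errorState, hZ, Matrix.fromBlocks_multiply, hFh, hGh, Matrix.mul_add,
      Matrix.mul_sub, Matrix.sub_mul, Matrix.mul_assoc]
    congr 1 <;> abel
  have hXB : symBlock Z Z Y * errorInput B D G =
      Matrix.fromRows (Z * B) (Y * B + Gh * D) := by
    simp only [symBlock, errorInput, hZ, Matrix.fromBlocks_mul_fromRows, hGh,
      Matrix.mul_sub, Matrix.sub_mul, Matrix.mul_assoc]
    congr 1 <;> abel
  rw [hXA, hXB]
  convert h.submatrix (e := (Equiv.sumAssoc n n _).trans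
    (.sumCongr (.refl n) (.sumCongr (.refl n) (Equiv.sumAssoc n n m)))) (Equiv.injective _) using 1
  ext i j
  rcases i with (i | i) | (i | i) | i <;> rcases j with (j | j) | (j | j) | j <;> rfl

lemma posDef_errorOutput {C : Matrix p n ℝ} {D : Matrix p m ℝ} {L : Matrix q n ℝ}
    {W : Matrix q q ℝ} {Y Z : Matrix n n ℝ} {Hh : Matrix q n ℝ} {Kh : Matrix q p ℝ}
    (h : (lmiOutput C D L W Y Z Hh Kh).PosDef) :
    (symBlock W (Matrix.fromCols (errorOutput C L Hh Kh) (-(Kh * D)))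
      (symBlock (symBlock Z Z Y) 0 1)).PosDef := by
  convert h.submatrix (e := Equiv.sumCongr (.refl q) (Equiv.sumAssoc n n m))
    (Equiv.injective _) using 1
  ext i j
  rcases i with i | (i | i) | i <;> rcases j with j | (j | j) | j <;> rfl

end ClosedLoop

/-! ### Verification of the design constraints. -/

section Synthesis

variable {n m p q : Type*} [Fintype n] [DecidableEq n] [Fintype m] [DecidableEq m]
  [Fintype p] [Fintype q] [DecidableEq q]

lemma sensitivityTransfer_eq {C : Matrix p n ℝ} {T R F : Matrix n n ℝ} {G : Matrix n p ℝ}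
    {H : Matrix q n ℝ} {K : Matrix q p ℝ} (hR : IsUnit R) :
    sensitivityTransfer C T (R * F * R⁻¹) (R * G) (H * R⁻¹) K =
      transferFunction F (G * C * T) H (K * C * T) := by
  have hRu := (Matrix.isUnit_iff_isUnit_det _).mp hR
  refine transferFunction_congr hR ?_ ?_ ?_ <;>
    simp [Matrix.mul_assoc, Matrix.nonsing_inv_mul _ hRu]

lemma posDef_sub_of_lmiState {A : Matrix n n ℝ} {B : Matrix n m ℝ} {C : Matrix p n ℝ}
    {D : Matrix p m ℝ} {Y Z : Matrix n n ℝ} {Fh : Matrix n n ℝ} {Gh : Matrix n p ℝ}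
    (h : (lmiState A B C D Y Z Fh Gh).PosDef) : (Y - Z).PosDef := by
  have hZ : Zᵀ = Z := h.symBlock_inl.isHermitian.eq
  have hY : Yᵀ = Y := h.symBlock_inr.symBlock_inl.isHermitian.eq
  refine .of_dotProduct_mulVec_pos ?_ fun x hx => ?_
  · rw [Matrix.IsHermitian, Matrix.conjTranspose_eq_transpose_of_trivial, Matrix.transpose_sub,
      hY, hZ]
  · have key := h.dotProduct_mulVec_pos (x := Sum.elim x (Sum.elim (-x) (Sum.elim 0
      (Sum.elim 0 0)))) (by
        contrapose! hx
        funext i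
        simpa using congrFun hx (.inl i))
    simp only [lmiState, star_trivial, symBlock_form, Matrix.fromCols_mulVec_sumElim,
      Matrix.mulVec_zero, Matrix.mulVec_neg, Matrix.sub_mulVec,
      dotProduct_sub, dotProduct_neg, neg_dotProduct, dotProduct_zero, add_zero,
      neg_neg, mul_zero] at key ⊢
    linarith

/-- Every state coordinate change of the filter `(-(Y - Z)⁻¹ Fh, -(Y - Z)⁻¹ Gh, Hh, Kh)` meets the
design constraints. -/
lemma filterConstraints_of_lmi [Nonempty q] {A : Matrix n n ℝ} {B : Matrix n m ℝ}
    {C : Matrix p n ℝ} {D : Matrix p m ℝ} {L : Matrix q n ℝ} {T : Matrix n n ℝ} {ρ μ lam : ℝ}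
    (hρ : 0 < ρ) {W : Matrix q q ℝ} {Y Z Fh : Matrix n n ℝ} {Gh : Matrix n p ℝ}
    {Hh : Matrix q n ℝ} {Kh : Matrix q p ℝ} (hW : W.trace < μ)
    (hOutput : (lmiOutput C D L W Y Z Hh Kh).PosDef)
    (hSens : (lmiSensitivity C T ρ lam Y Z Fh Gh Hh Kh).PosDef)
    (hState : (lmiState A B C D Y Z Fh Gh).PosDef) {R F : Matrix n n ℝ} {G : Matrix n p ℝ}
    (hR : IsUnit R) (hF : (Y - Z) * F = -Fh) (hG : (Y - Z) * G = -Gh) :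
    FilterConstraints A B C D L T ρ μ lam (R * F * R⁻¹) (R * G) (Hh * R⁻¹) Kh := by
  have hRu := (Matrix.isUnit_iff_isUnit_det _).mp hR
  have hN := posDef_boundedReal_of_lmiSensitivity hSens hF hG
  have hE := posDef_errorState hState hF hG
  have hFs : IsSchurStable F := by
    apply IsSchurStable.of_posDef_symBlock (P := Y - Z)
    convert hN.submatrix (e := Sum.map Sum.inl Sum.inl)
      (Sum.map_injective.mpr ⟨Sum.inl_injective, Sum.inl_injective⟩) using 1
    ext i j
    rcases i with i | i <;> rcases j with j | j <;> rfl
  have hEs : IsSchurStable (errorState A C F G) := by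
    apply IsSchurStable.of_posDef_symBlock (P := symBlock Z Z Y)
    convert hE.submatrix (e := Sum.map id Sum.inl)
      (Sum.map_injective.mpr ⟨Function.injective_id, Sum.inl_injective⟩) using 1
    ext i j
    rcases i with i | i <;> rcases j with j | j <;> rfl
  -- A nonempty output provides a diagonal entry of the block `(lam/ρ²)I`.
  have hc : 0 < lam / ρ ^ 2 := by
    have h := (hN.symBlock_inl.submatrix (Sum.inr_injective)).diag_pos
      (i := Classical.arbitrary q)
    simpa using h
  have h2 := h2Norm_transferFunction_le hEs hE (posDef_errorOutput hOutput)
  rw [← errorTransfer_eq hR] at h2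
  have hinf := hinfNorm_transferFunction_le hc hFs hN.posSemidef
  rw [← sensitivityTransfer_eq hR] at hinf
  have hWt : 0 ≤ W.trace := hOutput.symBlock_inl.posSemidef.trace_nonneg
  refine ⟨hFs.congr hR ?_, ⟨?_, ?_⟩, ?_, ?_⟩
  · rw [Matrix.mul_assoc, Matrix.nonsing_inv_mul _ hRu, Matrix.mul_one]
  · exact ne_top_of_le_ne_top (ENNReal.rpow_ne_top_of_nonneg (by norm_num) ENNReal.ofReal_ne_top) h2
  · have h := ENNReal.toReal_mono
      (ENNReal.rpow_ne_top_of_nonneg (by norm_num) ENNReal.ofReal_ne_top) h2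
    rw [← ENNReal.toReal_rpow, ENNReal.toReal_ofReal hWt, ← Real.sqrt_eq_rpow] at h
    calc _ ≤ √W.trace ^ 2 := pow_le_pow_left₀ ENNReal.toReal_nonneg h 2
      _ = W.trace := Real.sq_sqrt hWt
      _ ≤ μ := hW.le
  · exact ne_top_of_le_ne_top ENNReal.ofReal_ne_top hinf
  · have h := ENNReal.toReal_mono ENNReal.ofReal_ne_top hinf
    rw [ENNReal.toReal_ofReal (Real.sqrt_nonneg _)] at h
    calc _ ≤ ρ ^ 2 * √(lam / ρ ^ 2) ^ 2 := by gcongr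
      _ = lam := by
        rw [Real.sq_sqrt hc.le]
        field_simp

end Synthesis

end FilterDesign

theorem mainTheorem5
    {n m p q : Type*} [Fintype n] [DecidableEq n] [Fintype m] [DecidableEq m]
    [Fintype p] [DecidableEq p] [Fintype q] [DecidableEq q] [Nonempty q]
    (A : Matrix n n ℝ) (B : Matrix n m ℝ) (C : Matrix p n ℝ) (D : Matrix p m ℝ)
    (L : Matrix q n ℝ) (S : Finset n) (ρ μ lam : ℝ)
    (hA : IsSchurStable A) (hρ : 0 < ρ)
    (W : Matrix q q ℝ) (Y Z : Matrix n n ℝ)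
    (Fh : Matrix n n ℝ) (Gh : Matrix n p ℝ) (Hh : Matrix q n ℝ) (Kh : Matrix q p ℝ)
    (hW : W.trace < μ)
    (hOutput : (lmiOutput C D L W Y Z Hh Kh).PosDef)
    (hSens : (lmiSensitivity C (selectionMatrix S) ρ lam Y Z Fh Gh Hh Kh).PosDef)
    (hState : (lmiState A B C D Y Z Fh Gh).PosDef) :
    (∃ (F : Matrix n n ℝ) (G : Matrix n p ℝ) (H : Matrix q n ℝ) (K : Matrix q p ℝ),
      FilterConstraints A B C D L (selectionMatrix S) ρ μ lam F G H K) ∧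
    IsUnit Z ∧
    (∃ U V : Matrix n n ℝ, IsUnit U ∧ IsUnit V ∧ V * Uᵀ = 1 - Y * Z⁻¹) ∧
    (∀ U V : Matrix n n ℝ, IsUnit U → IsUnit V → V * Uᵀ = 1 - Y * Z⁻¹ →
      FilterConstraints A B C D L (selectionMatrix S) ρ μ lam
        (V⁻¹ * Fh * Z⁻¹ * (Uᵀ)⁻¹) (V⁻¹ * Gh) (Hh * Z⁻¹ * (Uᵀ)⁻¹) Kh) := by
  have hZ : IsUnit Z := hState.symBlock_inl.isUnit
  have hZu := (Matrix.isUnit_iff_isUnit_det _).mp hZ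
  have hΔ : IsUnit (Y - Z) := (posDef_sub_of_lmiState hState).isUnit
  have hΔu := (Matrix.isUnit_iff_isUnit_det _).mp hΔ
  have hfac : 1 - Y * Z⁻¹ = -((Y - Z) * Z⁻¹) := by
    rw [Matrix.sub_mul, Matrix.mul_nonsing_inv _ hZu, neg_sub]
  have hfacu : IsUnit (1 - Y * Z⁻¹) := by
    rw [hfac]
    exact (hΔ.mul ((Matrix.isUnit_nonsing_inv_iff).mpr hZ)).neg
  have hUV : ∃ U V : Matrix n n ℝ, IsUnit U ∧ IsUnit V ∧ V * Uᵀ = 1 - Y * Z⁻¹ :=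
    ⟨1, 1 - Y * Z⁻¹, isUnit_one, hfacu, by simp⟩
  have hall : ∀ U V : Matrix n n ℝ, IsUnit U → IsUnit V → V * Uᵀ = 1 - Y * Z⁻¹ →
      FilterConstraints A B C D L (selectionMatrix S) ρ μ lam
        (V⁻¹ * Fh * Z⁻¹ * (Uᵀ)⁻¹) (V⁻¹ * Gh) (Hh * Z⁻¹ * (Uᵀ)⁻¹) Kh := by
    intro U V hU hV h
    have hUt : IsUnit Uᵀ := (Matrix.isUnit_transpose U).mpr hU
    have hUu := (Matrix.isUnit_iff_isUnit_det _).mp hUt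
    have hVinv : V⁻¹ = -(Uᵀ * Z * (Y - Z)⁻¹) := by
      apply Matrix.inv_eq_right_inv
      rw [Matrix.mul_neg, ← Matrix.mul_assoc, ← Matrix.mul_assoc, h, hfac, Matrix.neg_mul,
        Matrix.neg_mul, neg_neg, Matrix.mul_assoc _ Z⁻¹, Matrix.nonsing_inv_mul _ hZu,
        Matrix.mul_one, Matrix.mul_nonsing_inv _ hΔu]
    -- The coordinate change is `R = Uᵀ Z`, with `R⁻¹ = Z⁻¹ U⁻ᵀ` and `V⁻¹ = -R (Y - Z)⁻¹`.
    have key := filterConstraints_of_lmi hρ hW hOutput hSens hState (hUt.mul hZ)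
      (F := -((Y - Z)⁻¹ * Fh)) (G := -((Y - Z)⁻¹ * Gh))
      (by rw [Matrix.mul_neg, ← Matrix.mul_assoc, Matrix.mul_nonsing_inv _ hΔu, Matrix.one_mul])
      (by rw [Matrix.mul_neg, ← Matrix.mul_assoc, Matrix.mul_nonsing_inv _ hΔu, Matrix.one_mul])
    simpa only [hVinv, Matrix.mul_inv_rev, Matrix.mul_neg, Matrix.neg_mul, Matrix.mul_assoc]
      using key
  obtain ⟨U, V, hU, hV, h⟩ := hUV
  exact ⟨⟨_, _, _, _, hall U V hU hV h⟩, hZ, ⟨U, V, hU, hV, h⟩, hall⟩
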